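/- An overpartition $\pi$ is a partition (a finite multiset of positive integers, the parts, possibly empty) in which, for each size that occurs, the first occurrence may be overlined; its weight $|\pi|$ is the sum of the sizes of all its parts. Let $\mathcal{G}_O^{N}$ be the set of overpartitions that have at least one non-overlined part and in which the size of every non-overlined part is greater than the size of every overlined part. Write $(a;q)_\infty=\prod_{i\ge 0}(1-aq^i)$ and $(a;q)_n=\prod_{i=0}^{n-1}(1-aq^i)$. Then for every complex number $q$ with $|q|<1$, \[ \sum_{\pi\in\mathcal{G}_O^{N}}q^{|\pi|}=\frac{1}{(q;q)_\infty}\sum_{n\geq 1}q^n(q^2;q^2)_{n-1}=(-q;q)_\infty\sum_{n\geq 0}\frac{q^{2n+1}}{1-q^{2n+1}}\,\frac{1}{(q^2;q^2)_n}, \] where all the infinite products converge, $(q;q)_\infty\neq 0$, and all the series converge absolutely. -/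

import Mathlib

/-- An overpartition: a partition (a finite multiset of positive integers) together with the set of
those sizes whose first occurrence is overlined. -/
@[ext]
structure Overpartition where
  /-- the sizes of all parts, overlined or not, with multiplicity -/
  parts : Multiset ℕ
  parts_pos : ∀ a ∈ parts, 0 < a
  /-- the sizes of the overlined parts -/
  overlined : Finset ℕ
  overlined_subset : ∀ b ∈ overlined, b ∈ parts

namespace Overpartition

/-- The weight `|π|`: the sum of the sizes of all parts. -/
def weight (π : Overpartition) : ℕ := π.parts.sum

/-- The sizes of the non-overlined parts, with multiplicity: one copy of every overlined size is
removed from the multiset of all parts. -/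
def nonOverlined (π : Overpartition) : Multiset ℕ := π.parts - π.overlined.val

/-- The overpartitions that have a non-overlined part and in which every non-overlined part
has size greater than every overlined part. -/
def GON : Set Overpartition :=
  {π | π.nonOverlined ≠ 0 ∧ ∀ a ∈ π.nonOverlined, ∀ b ∈ π.overlined, b < a}

end Overpartition

/-- The infinite `q`-Pochhammer symbol `(a;q)_∞ = ∏_{i ≥ 0} (1 - a q^i)`. -/
noncomputable def qPochInf (a q : ℂ) : ℂ := ∏' i : ℕ, (1 - a * q ^ i)

/-- The finite `q`-Pochhammer symbol `(a;q)_n = ∏_{0 ≤ i < n} (1 - a q^i)`; for `|q| < 1` it is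
the quotient `(a;q)_∞ / (a q^n;q)_∞` whenever the denominator is nonzero. -/
def qPoch (a q : ℂ) (n : ℕ) : ℂ := ∏ i ∈ Finset.range n, (1 - a * q ^ i)

open Filter Topology

/-! Sort `GON` by the smallest non-overlined size n. The other non-overlined parts form any multiset
of sizes ≥ n, counted by 1/(q^n;q)_∞, and the overlined ones any set of sizes < n, counted by
(-q;q)_{n-1}. Since (q;q)_{n-1} (q^n;q)_∞ = (q;q)_∞ and (q;q)_{n-1} (-q;q)_{n-1} = (q²;q²)_{n-1},
summing over n gives the first identity (`equivGON`, `tsum_GON_fiber`).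

For the second, put Q = q² and write (Q;Q)_m = (Q;Q)_∞ / (Q^{m+1};Q)_∞. Euler's series for the
reciprocal turns the sum into a double series; summing over m first leaves geometric series of ratio
q^{2k+1} (`tsum_pow_mul_qPoch`). Finally (q²;q²)_∞ = (q;q)_∞ (-q;q)_∞. -/

/-! ### Convergence and product rules for q-Pochhammer symbols -/

theorem summable_norm_mul_pow (a : ℂ) {q : ℂ} (hq : ‖q‖ < 1) :
    Summable fun i : ℕ => ‖-(a * q ^ i)‖ := by
  simpa [norm_mul, norm_pow] using
    (summable_geometric_of_lt_one (norm_nonneg q) hq).mul_left ‖a‖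

theorem multipliable_qPochInf (a : ℂ) {q : ℂ} (hq : ‖q‖ < 1) :
    Multipliable fun i : ℕ => 1 - a * q ^ i := by
  simpa [sub_eq_add_neg] using multipliable_one_add_of_summable (summable_norm_mul_pow a hq)

theorem one_sub_mul_pow_ne_zero {a q : ℂ} (ha : ‖a‖ < 1) (hq : ‖q‖ < 1) (i : ℕ) :
    1 - a * q ^ i ≠ 0 := by
  intro h
  have h1 : ‖a * q ^ i‖ = 1 := by rw [← sub_eq_zero.mp h, norm_one]
  rw [norm_mul, norm_pow] at h1
  have h2 : ‖q‖ ^ i ≤ 1 := pow_le_one₀ (norm_nonneg q) hq.le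
  nlinarith [norm_nonneg a]

theorem qPochInf_ne_zero {a q : ℂ} (ha : ‖a‖ < 1) (hq : ‖q‖ < 1) : qPochInf a q ≠ 0 := by
  have := tprod_one_add_ne_zero_of_summable (f := fun i : ℕ => -(a * q ^ i))
    (fun i => by simpa [sub_eq_add_neg] using one_sub_mul_pow_ne_zero ha hq i)
    (summable_norm_mul_pow a hq)
  simpa [qPochInf, sub_eq_add_neg] using this

theorem qPoch_ne_zero {a q : ℂ} (ha : ‖a‖ < 1) (hq : ‖q‖ < 1) (n : ℕ) : qPoch a q n ≠ 0 :=
  Finset.prod_ne_zero_iff.mpr fun i _ => one_sub_mul_pow_ne_zero ha hq i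

theorem tendsto_qPoch (a : ℂ) {q : ℂ} (hq : ‖q‖ < 1) :
    Tendsto (qPoch a q) atTop (𝓝 (qPochInf a q)) :=
  (multipliable_qPochInf a hq).hasProd.tendsto_prod_nat

theorem qPoch_mul_qPochInf (a : ℂ) {q : ℂ} (hq : ‖q‖ < 1) (n : ℕ) :
    qPoch a q n * qPochInf (a * q ^ n) q = qPochInf a q := by
  have h := Multipliable.prod_mul_tprod_nat_mul' (f := fun i : ℕ => 1 - a * q ^ i) (k := n)
    (by simpa [pow_add, mul_assoc, mul_comm, mul_left_comm] using
      multipliable_qPochInf (a * q ^ n) hq)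
  rw [qPoch, qPochInf, qPochInf, ← h]
  congr 1
  exact tprod_congr fun i => by ring

theorem qPoch_mul_qPoch_neg (a q : ℂ) (n : ℕ) :
    qPoch a q n * qPoch (-a) q n = qPoch (a ^ 2) (q ^ 2) n := by
  rw [qPoch, qPoch, qPoch, ← Finset.prod_mul_distrib]
  exact Finset.prod_congr rfl fun i _ => by ring

theorem qPochInf_mul_qPochInf_neg (a : ℂ) {q : ℂ} (hq : ‖q‖ < 1) :
    qPochInf a q * qPochInf (-a) q = qPochInf (a ^ 2) (q ^ 2) := by
  rw [qPochInf, qPochInf, qPochInf,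
    ← (multipliable_qPochInf a hq).tprod_mul (multipliable_qPochInf (-a) hq)]
  exact tprod_congr fun i => by ring

/-- Iterate the recurrence and pass to the limit. This evaluates both Euler's series and the
generating function of `multisetsGE n`. -/
theorem eq_qPochInf_mul_of_recurrence {F : ℕ → ℂ} {a q c : ℂ} (hq : ‖q‖ < 1)
    (hF : ∀ n, (1 - a * q ^ n) * F n = F (n + 1)) (hlim : Tendsto F atTop (𝓝 c)) :
    qPochInf a q * F 0 = c := by
  have h : ∀ n, qPoch a q n * F 0 = F n := by
    intro n
    induction n with
    | zero => simp [qPoch]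
    | succ n ih =>
      rw [← hF, ← ih, qPoch, qPoch, Finset.prod_range_succ]
      ring
  refine tendsto_nhds_unique ((tendsto_qPoch a hq).mul_const (F 0)) ?_
  simpa only [h] using hlim

/-! ### Euler's expansion of `1 / (z;q)_∞` -/

theorem exists_norm_inv_qPoch_le {a q : ℂ} (ha : ‖a‖ < 1) (hq : ‖q‖ < 1) :
    ∃ C, ∀ n, ‖(qPoch a q n)⁻¹‖ ≤ C := by
  obtain ⟨C, hC⟩ :=
    (((tendsto_qPoch a hq).inv₀ (qPochInf_ne_zero ha hq)).norm).bddAbove_range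
  exact ⟨C, fun n => hC ⟨n, rfl⟩⟩

theorem summable_norm_pow_div_qPoch {z q : ℂ} (hz : ‖z‖ < 1) (hq : ‖q‖ < 1) :
    Summable fun k : ℕ => ‖z ^ k / qPoch q q k‖ := by
  obtain ⟨C, hC⟩ := exists_norm_inv_qPoch_le hq hq
  refine Summable.of_nonneg_of_le (fun _ => norm_nonneg _) (fun k => ?_)
    ((summable_geometric_of_lt_one (norm_nonneg z) hz).mul_right C)
  rw [div_eq_mul_inv, norm_mul, norm_pow]
  exact mul_le_mul_of_nonneg_left (hC k) (by positivity)

/-- In z^k - (zq)^k the factor 1 - q^k cancels the last factor of (q;q)_k, so the difference of the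
two series is z times the first, shifted by one. -/
theorem one_sub_mul_tsum_pow_div_qPoch {z q : ℂ} (hz : ‖z‖ < 1) (hq : ‖q‖ < 1) :
    (1 - z) * ∑' k : ℕ, z ^ k / qPoch q q k = ∑' k : ℕ, (z * q) ^ k / qPoch q q k := by
  have hzq : ‖z * q‖ < 1 := by
    rw [norm_mul]
    nlinarith [norm_nonneg z, norm_nonneg q]
  have hs := (summable_norm_pow_div_qPoch hz hq).of_norm
  have hs' := (summable_norm_pow_div_qPoch hzq hq).of_norm
  have h1 : ∑' k : ℕ, z ^ k / qPoch q q k - ∑' k : ℕ, (z * q) ^ k / qPoch q q k =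
      z * ∑' k : ℕ, z ^ k / qPoch q q k := by
    rw [← hs.tsum_sub hs', (hs.sub hs').tsum_eq_zero_add, ← tsum_mul_left]
    simp only [pow_zero, sub_self, zero_add]
    refine tsum_congr fun k => ?_
    have h2 := qPoch_ne_zero hq hq k
    have h3 := one_sub_mul_pow_ne_zero hq hq k
    rw [qPoch, Finset.prod_range_succ, ← qPoch]
    field_simp
    ring
  linear_combination h1

theorem qPochInf_mul_tsum_pow_div_qPoch {z q : ℂ} (hz : ‖z‖ < 1) (hq : ‖q‖ < 1) :
    qPochInf z q * ∑' k : ℕ, z ^ k / qPoch q q k = 1 := by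
  have hle : ∀ n : ℕ, ‖z * q ^ n‖ ≤ ‖z‖ := fun n => by
    rw [norm_mul, norm_pow]
    exact mul_le_of_le_one_right (norm_nonneg z) (pow_le_one₀ (norm_nonneg q) hq.le)
  have h := eq_qPochInf_mul_of_recurrence (a := z) (c := 1)
    (F := fun n => ∑' k : ℕ, (z * q ^ n) ^ k / qPoch q q k) hq
    (fun n => by
      rw [one_sub_mul_tsum_pow_div_qPoch ((hle n).trans_lt hz) hq, mul_assoc, ← pow_succ]) ?_
  · simpa using h
  · have hlim := tendsto_tsum_of_dominated_convergence (𝓕 := atTop)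
      (f := fun (n : ℕ) (k : ℕ) => (z * q ^ n) ^ k / qPoch q q k)
      (g := fun k => (z * 0) ^ k / qPoch q q k) (summable_norm_pow_div_qPoch hz hq)
      (fun k => (((tendsto_pow_atTop_nhds_zero_of_norm_lt_one hq).const_mul z).pow k).div_const _)
      (Eventually.of_forall fun n k => by
        rw [norm_div, norm_div, norm_pow, norm_pow]
        gcongr
        exact hle n)
    -- At z = 0 only the term k = 0 survives, because 0^0 = 1.
    rw [tsum_eq_single 0 (fun k hk => by simp [hk])] at hlim
    simpa [qPoch] using hlim

theorem qPoch_self_eq_tsum {q : ℂ} (hq : ‖q‖ < 1) (m : ℕ) :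
    qPoch q q m = qPochInf q q * ∑' k : ℕ, (q ^ (m + 1)) ^ k / qPoch q q k := by
  have hm : ‖q ^ (m + 1)‖ < 1 := by
    rw [norm_pow]
    exact pow_lt_one₀ (norm_nonneg q) hq (by simp)
  have h1 := qPoch_mul_qPochInf q hq m
  rw [← pow_succ'] at h1
  rw [← h1, mul_assoc, qPochInf_mul_tsum_pow_div_qPoch hm hq, mul_one]

/-! ### The double series behind the second identity -/

theorem norm_sq_lt_one {q : ℂ} (hq : ‖q‖ < 1) : ‖q ^ 2‖ < 1 := by
  rw [norm_pow]
  exact pow_lt_one₀ (norm_nonneg q) hq (by simp)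

/-- Dominated by ‖q‖^(m+1) times Euler's series at z = q²; this licenses the exchange of sums. -/
theorem summable_pow_mul_div_qPoch {q : ℂ} (hq : ‖q‖ < 1) :
    Summable fun p : ℕ × ℕ =>
      q ^ (p.1 + 1) * (((q ^ 2) ^ (p.1 + 1)) ^ p.2 / qPoch (q ^ 2) (q ^ 2) p.2) := by
  have hQ := norm_sq_lt_one hq
  have hg : Summable fun m : ℕ => ‖q‖ ^ (m + 1) :=
    (summable_nat_add_iff 1).mpr (summable_geometric_of_lt_one (norm_nonneg q) hq)
  refine Summable.of_norm_bounded (hg.mul_of_nonneg (summable_norm_pow_div_qPoch hQ hQ)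
    (fun _ => by positivity) (fun _ => norm_nonneg _)) fun p => ?_
  rw [norm_mul, norm_pow, norm_div, norm_div, norm_pow _ p.2, norm_pow _ p.2]
  gcongr
  rw [norm_pow _ (p.1 + 1)]
  exact pow_le_of_le_one (norm_nonneg _) hQ.le (by simp)

theorem tsum_pow_mul_div_qPoch {q : ℂ} (hq : ‖q‖ < 1) (k : ℕ) :
    ∑' m : ℕ, q ^ (m + 1) * (((q ^ 2) ^ (m + 1)) ^ k / qPoch (q ^ 2) (q ^ 2) k) =
      q ^ (2 * k + 1) / ((1 - q ^ (2 * k + 1)) * qPoch (q ^ 2) (q ^ 2) k) := by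
  have hk : ‖q ^ (2 * k + 1)‖ < 1 := by
    rw [norm_pow]
    exact pow_lt_one₀ (norm_nonneg q) hq (by simp)
  have : ∀ m : ℕ, q ^ (m + 1) * (((q ^ 2) ^ (m + 1)) ^ k / qPoch (q ^ 2) (q ^ 2) k) =
      q ^ (2 * k + 1) / qPoch (q ^ 2) (q ^ 2) k * (q ^ (2 * k + 1)) ^ m := fun m => by ring
  simp only [this]
  rw [tsum_mul_left, tsum_geometric_of_norm_lt_one hk, ← div_eq_mul_inv, div_div, mul_comm (qPoch _ _ _)]

theorem summable_odd_pow_div {q : ℂ} (hq : ‖q‖ < 1) :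
    Summable fun n : ℕ =>
      q ^ (2 * n + 1) / ((1 - q ^ (2 * n + 1)) * qPoch (q ^ 2) (q ^ 2) n) := by
  simpa only [Function.comp_apply, Prod.fst_swap, Prod.snd_swap, Equiv.prodComm_apply,
    tsum_pow_mul_div_qPoch hq] using
    ((Equiv.prodComm ℕ ℕ).summable_iff.mpr (summable_pow_mul_div_qPoch hq)).prod

theorem pow_mul_qPoch_eq_tsum {q : ℂ} (hq : ‖q‖ < 1) (n : ℕ) :
    q ^ (n + 1) * qPoch (q ^ 2) (q ^ 2) n = qPochInf (q ^ 2) (q ^ 2) *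
      ∑' k : ℕ, q ^ (n + 1) * (((q ^ 2) ^ (n + 1)) ^ k / qPoch (q ^ 2) (q ^ 2) k) := by
  rw [tsum_mul_left, qPoch_self_eq_tsum (norm_sq_lt_one hq) n]
  exact mul_left_comm _ _ _

theorem summable_pow_mul_qPoch {q : ℂ} (hq : ‖q‖ < 1) :
    Summable fun n : ℕ => q ^ (n + 1) * qPoch (q ^ 2) (q ^ 2) n :=
  ((summable_pow_mul_div_qPoch hq).prod.mul_left (qPochInf (q ^ 2) (q ^ 2))).congr
    fun n => (pow_mul_qPoch_eq_tsum hq n).symm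

theorem tsum_pow_mul_qPoch {q : ℂ} (hq : ‖q‖ < 1) :
    ∑' n : ℕ, q ^ (n + 1) * qPoch (q ^ 2) (q ^ 2) n =
      qPochInf (q ^ 2) (q ^ 2) *
        ∑' n : ℕ, q ^ (2 * n + 1) / ((1 - q ^ (2 * n + 1)) * qPoch (q ^ 2) (q ^ 2) n) := by
  have hcomm := Summable.tsum_comm (f := fun n k : ℕ => q ^ (n + 1) *
    (((q ^ 2) ^ (n + 1)) ^ k / qPoch (q ^ 2) (q ^ 2) k)) (summable_pow_mul_div_qPoch hq)
  rw [tsum_congr (pow_mul_qPoch_eq_tsum hq), tsum_mul_left, ← hcomm,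
    tsum_congr (tsum_pow_mul_div_qPoch hq)]

/-! ### Multisets of positive integers with all elements at least `n` -/

/-- The multisets of natural numbers all of whose elements are at least `n`. -/
def multisetsGE (n : ℕ) : Set (Multiset ℕ) := {M | ∀ a ∈ M, n ≤ a}

/-- The multisets of natural numbers all of whose elements lie between `1` and `N`. -/
def multisetsIcc (N : ℕ) : Set (Multiset ℕ) := {M | ∀ a ∈ M, 1 ≤ a ∧ a ≤ N}

theorem multisetsGE_anti {m n : ℕ} (h : m ≤ n) : multisetsGE n ⊆ multisetsGE m :=
  fun _ hM a ha => h.trans (hM a ha)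

/-- Splitting off the elements equal to `N + 1`. -/
def splitLargest (N : ℕ) (M : multisetsIcc (N + 1)) : ℕ × multisetsIcc N :=
  (M.val.count (N + 1), ⟨M.val.filter (· ≠ N + 1), fun a ha => by
    have h := M.2 a (Multiset.mem_filter.mp ha).1
    have h' := (Multiset.mem_filter.mp ha).2
    omega⟩)

theorem replicate_add_splitLargest (N : ℕ) (M : multisetsIcc (N + 1)) :
    Multiset.replicate (splitLargest N M).1 (N + 1) + (splitLargest N M).2.val = M.val := by
  rw [splitLargest, ← Multiset.filter_eq']
  exact Multiset.filter_add_not (· = N + 1) M.val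

theorem splitLargest_injective (N : ℕ) : Function.Injective (splitLargest N) := fun M M' h =>
  Subtype.ext (by rw [← replicate_add_splitLargest, h, replicate_add_splitLargest])

/-- Each size i + 1 contributes 1/(1 - r^(i+1)) ≤ 1 + r^(i+1)/(1 - r). In this form the product is
bounded uniformly in N by an exponential. -/
theorem summable_tsum_multisetsIcc_le {r : ℝ} (h0 : 0 ≤ r) (h1 : r < 1) (N : ℕ) :
    Summable (fun M : multisetsIcc N => r ^ M.val.sum) ∧
      ∑' M : multisetsIcc N, r ^ M.val.sum ≤ ∏ i ∈ Finset.range N, (1 + r ^ i * (r / (1 - r))) := by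
  have h1' : 0 < 1 - r := by linarith
  induction N with
  | zero =>
    have : Unique (multisetsIcc 0) :=
      ⟨⟨⟨0, by simp [multisetsIcc]⟩⟩, fun M => Subtype.ext <|
        Multiset.eq_zero_of_forall_notMem fun a ha => by have := M.2 a ha; omega⟩
    have hd : (default : multisetsIcc 0).val = 0 :=
      Multiset.eq_zero_of_forall_notMem fun a ha => by
        have := (default : multisetsIcc 0).2 a ha; omega
    refine ⟨Summable.of_finite, ?_⟩
    rw [tsum_fintype, Fintype.sum_unique, hd]
    simp
  | succ N ih =>
    obtain ⟨hs, hle⟩ := ih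
    have hx : r ^ (N + 1) ≤ r := by simpa using pow_le_pow_of_le_one h0 h1.le (show 1 ≤ N + 1 by simp)
    have hx1 : r ^ (N + 1) < 1 := hx.trans_lt h1
    have hx0 : 0 ≤ r ^ (N + 1) := by positivity
    have hg := summable_geometric_of_lt_one hx0 hx1
    have hp : Summable fun p : ℕ × multisetsIcc N => (r ^ (N + 1)) ^ p.1 * r ^ p.2.val.sum :=
      hg.mul_of_nonneg hs (fun _ => by positivity) (fun _ => by positivity)
    have heq : (fun M : multisetsIcc (N + 1) => r ^ M.val.sum) =
        (fun p : ℕ × multisetsIcc N => (r ^ (N + 1)) ^ p.1 * r ^ p.2.val.sum) ∘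
          splitLargest N := by
      funext M
      conv_lhs => rw [← replicate_add_splitLargest]
      rw [Multiset.sum_add, Multiset.sum_replicate, pow_add, smul_eq_mul, mul_comm, pow_mul',
        mul_comm]
      simp [← pow_mul, mul_comm]
    have hS : Summable fun M : multisetsIcc (N + 1) => r ^ M.val.sum :=
      heq ▸ hp.comp_injective (splitLargest_injective N)
    refine ⟨hS, ?_⟩
    calc ∑' M : multisetsIcc (N + 1), r ^ M.val.sum
        ≤ ∑' p : ℕ × multisetsIcc N, (r ^ (N + 1)) ^ p.1 * r ^ p.2.val.sum :=
          hS.tsum_le_tsum_of_inj (splitLargest N) (splitLargest_injective N)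
            (fun _ _ => by positivity) (fun M => (congrFun heq M).le) hp
      _ = (1 - r ^ (N + 1))⁻¹ * ∑' M : multisetsIcc N, r ^ M.val.sum := by
          rw [← tsum_geometric_of_lt_one hx0 hx1, hg.tsum_mul_tsum hs hp]
      _ ≤ (1 + r ^ N * (r / (1 - r))) * ∏ i ∈ Finset.range N, (1 + r ^ i * (r / (1 - r))) := by
          refine mul_le_mul ?_ hle (tsum_nonneg fun _ => by positivity) (by positivity)
          have hx2 : 0 < 1 - r ^ (N + 1) := by linarith
          have : r ^ N * (r / (1 - r)) = r ^ (N + 1) / (1 - r) := by ring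
          rw [this, show (1 - r ^ (N + 1))⁻¹ = 1 + r ^ (N + 1) / (1 - r ^ (N + 1)) by
            field_simp; ring]
          gcongr
      _ = _ := by rw [Finset.prod_range_succ, mul_comm]

theorem summable_pow_sum_multisetsGE_one {r : ℝ} (h0 : 0 ≤ r) (h1 : r < 1) :
    Summable fun M : multisetsGE 1 => r ^ M.val.sum := by
  have h1' : 0 < 1 - r := by linarith
  have hg : Summable fun i : ℕ => r ^ i * (r / (1 - r)) :=
    (summable_geometric_of_lt_one h0 h1).mul_right _
  refine summable_of_sum_le (c := Real.exp (∑' i : ℕ, r ^ i * (r / (1 - r))))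
    (fun M => by positivity) fun u => ?_
  obtain ⟨N, hN⟩ : ∃ N, ∀ M ∈ u, M.val ∈ multisetsIcc N :=
    -- The total of all the sums bounds every element of every multiset in `u`.
    ⟨u.sum fun M => M.val.sum, fun M hM a ha => ⟨M.2 a ha, (Multiset.le_sum_of_mem ha).trans
      (Finset.single_le_sum (f := fun M : multisetsGE 1 => M.val.sum)
        (fun _ _ => Nat.zero_le _) hM)⟩⟩
  obtain ⟨hs, hle⟩ := summable_tsum_multisetsIcc_le h0 h1 N
  calc ∑ M ∈ u, r ^ M.val.sum
      = ∑ M ∈ u.attach, r ^ M.val.val.sum := (Finset.sum_attach u fun M => r ^ M.val.sum).symm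
    _ = ∑ M ∈ u.attach.map ⟨fun M => (⟨M.val.val, hN M.val M.2⟩ : multisetsIcc N),
          fun M M' h => Subtype.ext (Subtype.ext (Subtype.mk.inj h))⟩, r ^ M.val.sum := by
        rw [Finset.sum_map]
        rfl
    _ ≤ ∑' M : multisetsIcc N, r ^ M.val.sum := hs.sum_le_tsum _ fun _ _ => by positivity
    _ ≤ ∏ i ∈ Finset.range N, (1 + r ^ i * (r / (1 - r))) := hle
    _ ≤ Real.exp (∑ i ∈ Finset.range N, r ^ i * (r / (1 - r))) :=
        Real.prod_one_add_le_exp_sum _ fun i => by positivity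
    _ ≤ _ := Real.exp_le_exp.mpr (hg.sum_le_tsum _ fun i _ => by positivity)

theorem summable_norm_pow_sum_multisetsGE {q : ℂ} (hq : ‖q‖ < 1) {n : ℕ} (hn : 1 ≤ n) :
    Summable fun M : multisetsGE n => ‖q ^ M.val.sum‖ := by
  simpa only [norm_pow] using! (summable_pow_sum_multisetsGE_one (norm_nonneg q) hq).comp_injective
    (Set.inclusion_injective (multisetsGE_anti hn))

/-- Either n does not occur, or removing one copy of n leaves an arbitrary member of `multisetsGE
n`, at the cost of a factor q^n. -/
theorem one_sub_pow_mul_tsum_multisetsGE {q : ℂ} (hq : ‖q‖ < 1) {n : ℕ} (hn : 1 ≤ n) :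
    (1 - q ^ n) * ∑' M : multisetsGE n, q ^ M.val.sum =
      ∑' M : multisetsGE (n + 1), q ^ M.val.sum := by
  have hunion : multisetsGE n = (n ::ₘ ·) '' multisetsGE n ∪ multisetsGE (n + 1) := by
    ext M
    constructor
    · intro hM
      by_cases h : n ∈ M
      · obtain ⟨M', rfl⟩ := Multiset.exists_cons_of_mem h
        exact Or.inl ⟨M', fun a ha => hM a (Multiset.mem_cons_of_mem ha), rfl⟩
      · exact Or.inr fun a ha => lt_of_le_of_ne (hM a ha) fun hne => h (hne ▸ ha)
    · rintro (⟨M', hM', rfl⟩ | hM)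
      · intro a ha
        rcases Multiset.mem_cons.mp ha with rfl | ha
        exacts [le_rfl, hM' a ha]
      · exact multisetsGE_anti n.le_succ hM
  have hdisj : Disjoint ((n ::ₘ ·) '' multisetsGE n) (multisetsGE (n + 1)) := by
    rw [Set.disjoint_left]
    rintro _ ⟨M', -, rfl⟩ h
    have := h n (Multiset.mem_cons_self n M')
    omega
  have hinj : Function.Injective (n ::ₘ · : Multiset ℕ → Multiset ℕ) :=
    fun _ _ h => (Multiset.cons_inj_right n).mp h
  have hs := (summable_norm_pow_sum_multisetsGE hq hn).of_norm
  have hs' := (summable_norm_pow_sum_multisetsGE hq (hn.trans n.le_succ)).of_norm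
  have himg : Summable ((fun M : Multiset ℕ => q ^ M.sum) ∘
      ((↑) : (n ::ₘ ·) '' multisetsGE n → Multiset ℕ)) := by
    refine hs.comp_injective (i := Set.inclusion ?_) (Set.inclusion_injective _)
    conv_rhs => rw [hunion]
    exact Set.subset_union_left
  have h := Summable.tsum_union_disjoint (f := fun M : Multiset ℕ => q ^ M.sum) hdisj himg hs'
  rw [← hunion, tsum_image (fun M : Multiset ℕ => q ^ M.sum) hinj.injOn] at h
  simp only [Multiset.sum_cons, pow_add, tsum_mul_left] at h
  linear_combination h

/-- A multiset containing a drops out once n > a, so only the empty one survives. -/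
theorem tendsto_tsum_multisetsGE {q : ℂ} (hq : ‖q‖ < 1) :
    Tendsto (fun n => ∑' M : multisetsGE n, q ^ M.val.sum) atTop (𝓝 1) := by
  simp only [tsum_subtype (multisetsGE _) fun M => q ^ M.sum]
  have hb : Summable fun M : Multiset ℕ =>
      (multisetsGE 1).indicator (fun M => ‖q ^ M.sum‖) M :=
    summable_subtype_iff_indicator.mp (summable_norm_pow_sum_multisetsGE hq le_rfl)
  have hlim := tendsto_tsum_of_dominated_convergence (𝓕 := atTop)
    (f := fun n => (multisetsGE n).indicator fun M => q ^ M.sum)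
    (g := fun M : Multiset ℕ => if M = 0 then (1 : ℂ) else 0) hb (fun M => ?_) ?_
  · rwa [tsum_ite_eq] at hlim
  · split_ifs with h
    · subst h
      simp [multisetsGE]
    · obtain ⟨a, ha⟩ := Multiset.exists_mem_of_ne_zero h
      refine tendsto_const_nhds.congr' ?_
      filter_upwards [eventually_gt_atTop a] with n hn
      rw [Set.indicator_of_notMem]
      exact fun hM => (hM a ha).not_gt hn
  -- The case n = 0 must be avoided: zeros may then be repeated freely and the series diverges.
  · filter_upwards [eventually_ge_atTop 1] with n hn M
    rw [norm_indicator_eq_indicator_norm]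
    exact Set.indicator_le_indicator_of_subset (multisetsGE_anti hn) (fun _ => norm_nonneg _) M

theorem qPochInf_mul_tsum_multisetsGE {q : ℂ} (hq : ‖q‖ < 1) {n : ℕ} (hn : 1 ≤ n) :
    qPochInf (q ^ n) q * ∑' M : multisetsGE n, q ^ M.val.sum = 1 :=
  eq_qPochInf_mul_of_recurrence (F := fun k => ∑' M : multisetsGE (n + k), q ^ M.val.sum) hq
    (fun k => by
      rw [← pow_add]
      exact one_sub_pow_mul_tsum_multisetsGE hq (hn.trans (Nat.le_add_right n k)))
    ((tendsto_tsum_multisetsGE hq).comp (tendsto_add_atTop_nat n |>.congr fun k => add_comm k n))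

/-! ### The generating function of `GON` -/

namespace Overpartition

theorem overlined_val_le_parts (π : Overpartition) : π.overlined.val ≤ π.parts :=
  (Multiset.le_iff_subset π.overlined.nodup).mpr π.overlined_subset

theorem nonOverlined_add_overlined (π : Overpartition) :
    π.nonOverlined + π.overlined.val = π.parts :=
  Multiset.sub_add_cancel π.overlined_val_le_parts

/-- The non-overlined parts and the overlined parts, as multisets of positive integers. -/
def toProd (π : Overpartition) : multisetsGE 1 × multisetsGE 1 :=
  (⟨π.nonOverlined, fun a ha => π.parts_pos a (Multiset.mem_of_le (Multiset.sub_le_self _ _) ha)⟩,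
    ⟨π.overlined.val, fun a ha => π.parts_pos a (π.overlined_subset a ha)⟩)

theorem toProd_injective : Function.Injective toProd := fun π π' h => by
  have h1 : π.nonOverlined = π'.nonOverlined := congrArg (·.1.val) h
  have h2 : π.overlined.val = π'.overlined.val := congrArg (·.2.val) h
  ext1
  · rw [← nonOverlined_add_overlined, h1, h2, nonOverlined_add_overlined]
  · exact Finset.val_injective h2

theorem summable_pow_weight {q : ℂ} (hq : ‖q‖ < 1) :
    Summable fun π : Overpartition => q ^ π.weight := by
  have hs := summable_norm_pow_sum_multisetsGE hq le_rfl
  have := (summable_mul_of_summable_norm hs hs).comp_injective toProd_injective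
  refine this.congr fun π => ?_
  rw [Function.comp_apply, ← pow_add, toProd, ← Multiset.sum_add, nonOverlined_add_overlined,
    weight]

/-- The overpartition in `GON` with smallest non-overlined part `n`, further non-overlined parts
`M` and overlined parts `S`. -/
def ofSmallest (x : Σ n : ℕ+, multisetsGE n × (Finset.Ico 1 (n : ℕ)).powerset) : Overpartition where
  parts := (x.1 : ℕ) ::ₘ x.2.1.val + x.2.2.val.val
  parts_pos a ha := by
    rcases Multiset.mem_add.mp ha with ha | ha
    · rcases Multiset.mem_cons.mp ha with rfl | ha
      exacts [x.1.pos, x.1.pos.trans_le (x.2.1.2 a ha)]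
    · exact (Finset.mem_Ico.mp (Finset.mem_powerset.mp x.2.2.2 ha)).1
  overlined := x.2.2.val
  overlined_subset b hb := Multiset.mem_add.mpr (Or.inr hb)

theorem nonOverlined_ofSmallest
    (x : Σ n : ℕ+, multisetsGE n × (Finset.Ico 1 (n : ℕ)).powerset) :
    (ofSmallest x).nonOverlined = (x.1 : ℕ) ::ₘ x.2.1.val :=
  Multiset.add_sub_cancel_right

theorem le_of_mem_nonOverlined_ofSmallest
    (x : Σ n : ℕ+, multisetsGE n × (Finset.Ico 1 (n : ℕ)).powerset) :
    ∀ a ∈ (ofSmallest x).nonOverlined, (x.1 : ℕ) ≤ a := fun a ha => by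
  rw [nonOverlined_ofSmallest] at ha
  rcases Multiset.mem_cons.mp ha with rfl | ha
  exacts [le_rfl, x.2.1.2 a ha]

theorem mem_nonOverlined_ofSmallest
    (x : Σ n : ℕ+, multisetsGE n × (Finset.Ico 1 (n : ℕ)).powerset) :
    (x.1 : ℕ) ∈ (ofSmallest x).nonOverlined := by
  rw [nonOverlined_ofSmallest]
  exact Multiset.mem_cons_self _ _

theorem ofSmallest_mem_GON (x : Σ n : ℕ+, multisetsGE n × (Finset.Ico 1 (n : ℕ)).powerset) :
    ofSmallest x ∈ GON :=
  ⟨fun h => by simpa [h] using mem_nonOverlined_ofSmallest x, fun a ha _ hb =>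
    (Finset.mem_Ico.mp (Finset.mem_powerset.mp x.2.2.2 hb)).2.trans_le
      (le_of_mem_nonOverlined_ofSmallest x a ha)⟩

/-- The index n is recovered as the least non-overlined part; the other two components then follow
by cancellation. -/
theorem ofSmallest_injective : Function.Injective ofSmallest := fun x y h => by
  have hn : x.1 = y.1 := PNat.eq <| le_antisymm
    (le_of_mem_nonOverlined_ofSmallest x _ (h ▸ mem_nonOverlined_ofSmallest y))
    (le_of_mem_nonOverlined_ofSmallest y _ (h ▸ mem_nonOverlined_ofSmallest x))
  have hM := congrArg nonOverlined h
  have hS := congrArg overlined h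
  rw [nonOverlined_ofSmallest, nonOverlined_ofSmallest] at hM
  obtain ⟨n, M, S⟩ := x
  obtain ⟨n', M', S'⟩ := y
  obtain rfl : n = n' := hn
  obtain rfl : M = M' := Subtype.ext ((Multiset.cons_inj_right _).mp hM)
  obtain rfl : S = S' := Subtype.ext hS
  rfl

theorem exists_ofSmallest_eq {π : Overpartition} (hπ : π ∈ GON) : ∃ x, ofSmallest x = π := by
  obtain ⟨hne, hlt⟩ := hπ
  obtain ⟨n, hn, hmin⟩ := Finset.exists_min_image π.nonOverlined.toFinset id
    (Multiset.toFinset_nonempty.mpr hne)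
  rw [Multiset.mem_toFinset] at hn
  simp only [Multiset.mem_toFinset, id] at hmin
  have hpos : 0 < n := π.toProd.1.2 n hn
  refine ⟨⟨⟨n, hpos⟩, ⟨π.nonOverlined.erase n, fun a ha => hmin a (Multiset.mem_of_mem_erase ha)⟩,
    ⟨π.overlined, Finset.mem_powerset.mpr fun b hb => Finset.mem_Ico.mpr
      ⟨π.toProd.2.2 b hb, hlt n hn b hb⟩⟩⟩, ?_⟩
  ext1
  · change n ::ₘ π.nonOverlined.erase n + π.overlined.val = π.parts
    rw [Multiset.cons_erase hn, nonOverlined_add_overlined]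
  · rfl

/-- An overpartition in `GON` is determined by its smallest non-overlined part `n`, its further
non-overlined parts (all at least `n`) and its overlined parts (all less than `n`). -/
noncomputable def equivGON :
    (Σ n : ℕ+, multisetsGE n × (Finset.Ico 1 (n : ℕ)).powerset) ≃ GON :=
  Equiv.ofBijective (fun x => ⟨ofSmallest x, ofSmallest_mem_GON x⟩)
    ⟨fun _ _ h => ofSmallest_injective (congrArg Subtype.val h), fun π =>
      (exists_ofSmallest_eq π.2).imp fun _ h => Subtype.ext h⟩

theorem weight_equivGON (x : Σ n : ℕ+, multisetsGE n × (Finset.Ico 1 (n : ℕ)).powerset) :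
    (equivGON x).val.weight = x.1 + x.2.1.val.sum + ∑ i ∈ x.2.2.val, i := by
  change ((x.1 : ℕ) ::ₘ x.2.1.val + x.2.2.val.val).sum = _
  rw [Multiset.sum_add, Multiset.sum_cons, Finset.sum_val]
  rfl

end Overpartition

/-- Expand ∏ (1 + q^i) over 1 ≤ i ≤ n. -/
theorem tsum_powerset_Ico (q : ℂ) (n : ℕ) :
    ∑' S : (Finset.Ico 1 (n + 1)).powerset, q ^ ∑ i ∈ S.val, i = qPoch (-q) q n := by
  rw [Finset.tsum_subtype (Finset.Ico 1 (n + 1)).powerset fun S => q ^ ∑ i ∈ S, i]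
  simp only [← Finset.prod_pow_eq_pow_sum]
  rw [← Finset.prod_one_add, qPoch, Finset.prod_Ico_eq_prod_range]
  exact Finset.prod_congr rfl fun i _ => by ring

theorem tsum_GON_fiber {q : ℂ} (hq : ‖q‖ < 1) {n : ℕ} (hn : 1 ≤ n) :
    ∑' p : multisetsGE n × (Finset.Ico 1 n).powerset,
        q ^ (n + p.1.val.sum + ∑ i ∈ p.2.val, i) =
      1 / qPochInf q q * (q ^ n * qPoch (q ^ 2) (q ^ 2) (n - 1)) := by
  obtain ⟨m, rfl⟩ := Nat.exists_eq_add_of_le' hn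
  have h1 : ∑' p : multisetsGE (m + 1) × (Finset.Ico 1 (m + 1)).powerset,
      q ^ (m + 1 + p.1.val.sum + ∑ i ∈ p.2.val, i) =
      q ^ (m + 1) * ((∑' M : multisetsGE (m + 1), q ^ M.val.sum) * qPoch (-q) q m) := by
    rw [← tsum_powerset_Ico, tsum_mul_tsum_of_summable_norm
      (summable_norm_pow_sum_multisetsGE hq hn) Summable.of_finite, ← tsum_mul_left]
    exact tsum_congr fun p => by ring
  have h2 := qPochInf_mul_tsum_multisetsGE hq hn
  have h3 := qPoch_mul_qPochInf q hq m
  rw [← pow_succ'] at h3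
  have h4 := qPochInf_ne_zero hq hq
  -- Splitting (q;q)_∞ at m supplies (q;q)_m to pair with (-q;q)_m, and its tail cancels the
  -- multiset series.
  rw [h1, Nat.add_sub_cancel, ← qPoch_mul_qPoch_neg, one_div, eq_inv_mul_iff_mul_eq₀ h4, ← h3]
  linear_combination q ^ (m + 1) * qPoch q q m * qPoch (-q) q m * h2

theorem tsum_GON {q : ℂ} (hq : ‖q‖ < 1) :
    ∑' π : Overpartition.GON, q ^ π.val.weight =
      1 / qPochInf q q * ∑' n : ℕ+, q ^ (n : ℕ) * qPoch (q ^ 2) (q ^ 2) ((n : ℕ) - 1) := by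
  have hs : Summable fun π : Overpartition.GON => q ^ π.val.weight :=
    (Overpartition.summable_pow_weight hq).comp_injective Subtype.val_injective
  have hs' : Summable fun x => q ^ (Overpartition.equivGON x).val.weight :=
    hs.comp_injective Overpartition.equivGON.injective
  rw [← Overpartition.equivGON.tsum_eq, hs'.tsum_sigma, ← tsum_mul_left]
  simp only [Overpartition.weight_equivGON]
  exact tsum_congr fun n => tsum_GON_fiber hq n.pos

theorem mainTheorem9 (q : ℂ) (hq : ‖q‖ < 1) :
    -- the infinite products converge, and the one in a denominator is nonzero
    (Multipliable (fun i : ℕ => 1 - q * q ^ i) ∧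
      Multipliable (fun i : ℕ => 1 - (-q) * q ^ i) ∧ qPochInf q q ≠ 0) ∧
    -- the three series converge
    (Summable (fun π : Overpartition.GON => q ^ π.val.weight) ∧
      Summable (fun n : ℕ+ => q ^ (n : ℕ) * qPoch (q ^ 2) (q ^ 2) ((n : ℕ) - 1)) ∧
      Summable (fun n : ℕ =>
        q ^ (2 * n + 1) / ((1 - q ^ (2 * n + 1)) * qPoch (q ^ 2) (q ^ 2) n))) ∧
    -- the two identities
    ∑' π : Overpartition.GON, q ^ π.val.weight =
      1 / qPochInf q q *
        ∑' n : ℕ+, q ^ (n : ℕ) * qPoch (q ^ 2) (q ^ 2) ((n : ℕ) - 1) ∧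
    1 / qPochInf q q *
        ∑' n : ℕ+, q ^ (n : ℕ) * qPoch (q ^ 2) (q ^ 2) ((n : ℕ) - 1) =
      qPochInf (-q) q *
        ∑' n : ℕ, q ^ (2 * n + 1) / ((1 - q ^ (2 * n + 1)) * qPoch (q ^ 2) (q ^ 2) n) := by
  have hsucc : (fun n : ℕ+ => q ^ (n : ℕ) * qPoch (q ^ 2) (q ^ 2) ((n : ℕ) - 1)) =
      (fun m : ℕ => q ^ (m + 1) * qPoch (q ^ 2) (q ^ 2) m) ∘ Equiv.pnatEquivNat := by
    funext n
    change _ = q ^ ((n : ℕ) - 1 + 1) * _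
    rw [Nat.sub_add_cancel n.pos]
    rfl
  have hsum : Summable fun n : ℕ+ => q ^ (n : ℕ) * qPoch (q ^ 2) (q ^ 2) ((n : ℕ) - 1) := by
    rw [hsucc]
    exact Equiv.pnatEquivNat.summable_iff.mpr (summable_pow_mul_qPoch hq)
  have htsum : ∑' n : ℕ+, q ^ (n : ℕ) * qPoch (q ^ 2) (q ^ 2) ((n : ℕ) - 1) =
      ∑' n : ℕ, q ^ (n + 1) * qPoch (q ^ 2) (q ^ 2) n := by
    rw [hsucc]
    exact Equiv.pnatEquivNat.tsum_eq fun m : ℕ => q ^ (m + 1) * qPoch (q ^ 2) (q ^ 2) m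
  refine ⟨⟨multipliable_qPochInf q hq, multipliable_qPochInf (-q) hq, qPochInf_ne_zero hq hq⟩,
    ⟨(Overpartition.summable_pow_weight hq).comp_injective Subtype.val_injective, hsum,
      summable_odd_pow_div hq⟩, tsum_GON hq, ?_⟩
  rw [htsum, tsum_pow_mul_qPoch hq, ← qPochInf_mul_qPochInf_neg q hq, one_div, mul_assoc,
    inv_mul_cancel_left₀ (qPochInf_ne_zero hq hq)]
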